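/- For finitely many rational numbers $a_0,\dots,a_n$ let $\mathrm{den}(a_0,\dots,a_n)$ denote the smallest integer $d\geqslant 1$ such that $da_0,\dots,da_n$ are all integers, and let $(x)_0=1$, $(x)_n=x(x+1)\cdots(x+n-1)$ for $n \geqslant 1$ denote the Pochhammer symbol. Let $\alpha,\beta\in\mathbb{Q}\setminus\mathbb{Z}_{\leqslant 0}$. Then: (a) $$\limsup_{n\to+\infty}\ \mathrm{den}\left(\frac{(\alpha)_0}{(\beta)_0},\dots,\frac{(\alpha)_n}{(\beta)_n}\right)^{1/n}\leqslant \mathrm{den}(\alpha)^2\, e^{\mathrm{den}(\beta)}.$$ (b) For every integer $n\geqslant 1$, the number $\mathrm{den}(\alpha)^{2n}\,\dfrac{(\alpha)_n}{n!}$ is an integer, and $$\limsup_{n\to+\infty}\ \mathrm{den}\left(\frac{(\alpha)_0}{0!},\dots,\frac{(\alpha)_n}{n!}\right)^{1/n}\leqslant \mathrm{den}(\alpha)^2.$$ -/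

import Mathlib

open Filter

/-- The common denominator `den(a₀, …, aₙ)` of the rational numbers `a₀, …, aₙ`: the smallest
positive integer `d` such that `d a₀, …, d aₙ` are all integers. -/
noncomputable def commonDen (a : ℕ → ℚ) (n : ℕ) : ℕ :=
  sInf {d : ℕ | 0 < d ∧ ∀ k ≤ n, ∃ m : ℤ, (d : ℚ) * a k = m}

/-- The set in the definition of `commonDen` is nonempty, so that the minimum is attained. -/
theorem commonDen_spec (a : ℕ → ℚ) (n : ℕ) :
    0 < commonDen a n ∧ ∀ k ≤ n, ∃ m : ℤ, (commonDen a n : ℚ) * a k = m := by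
  refine Nat.sInf_mem (s := {d : ℕ | 0 < d ∧ ∀ k ≤ n, ∃ m : ℤ, (d : ℚ) * a k = m})
    ⟨∏ i ∈ Finset.range (n + 1), (a i).den, Finset.prod_pos fun i _ => (a i).pos, ?_⟩
  intro k hk
  obtain ⟨c, hc⟩ := Finset.dvd_prod_of_mem (fun i => (a i).den)
    (Finset.mem_range.2 (Nat.lt_succ_of_le hk))
  refine ⟨c * (a k).num, ?_⟩
  rw [hc]
  push_cast
  rw [← Rat.den_mul_eq_num (a k)]
  ring

/-- The Pochhammer symbol `(x)ₙ = x (x + 1) ⋯ (x + n - 1)` of a rational number, `(x)₀ = 1`. -/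
noncomputable def poch (x : ℚ) (n : ℕ) : ℚ :=
  (ascPochhammer ℚ n).eval x

/-!
The binomial-type quotients `(α)ₖ / k!` have denominators dividing `den(α) ^ (2k)`
(`exists_int_den_pow_mul_poch_div_factorial`). Indeed `den(α) ^ k (α)ₖ` is a product of `k` terms of
an arithmetic progression with difference `den(α)`. A prime `p` not dividing `den(α)` occurs in it
at least as often as in `k!`, while a prime dividing `den(α)` occurs at most `k` times in `k!`,
which the second factor `den(α) ^ k` makes up for.

For `(α)ₖ / (β)ₖ = ((α)ₖ / k!) (k! / (β)ₖ)` the second factor is, by partial fractions, an integral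
combination of the numbers `1 / (β + i)` with `i < k`
(`exists_int_mul_factorial_div_poch`). Their denominators divide the numerators of `β + i`, so that
all of them divide `lcm(1, …, M)` with `M = |num β| + n den(β)`. Hence the common denominator is at
most `den(α) ^ (2n) exp (ψ(M))` with the Chebyshev function `ψ`
(`commonDen_poch_div_poch_le`), and the claimed bound is a consequence of
`limsup ψ(x) / x ≤ 1` (`eventually_psi_le`).

That inequality is the upper half of the prime number theorem. It is obtained from the
non-vanishing of the zeta function on `re s = 1` by the upper half of the Wiener–Ikehara theorem
(`eventually_sum_le_of_LSeries_eq`). The Dirichlet series `∑ Λ(n) n ^ (-s)` is integrated against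
the triangle function over a segment of the line `re s = σ > 1`; as the Fourier transform of the
triangle function is the Fejér kernel, which is nonnegative, every finite part of the resulting
series is bounded by the contribution of the pole, which is at most the mass of the kernel, and a
contribution of the regular part. The latter converges as `σ` tends to `1` and is then small by the
Riemann–Lebesgue lemma (`eventually_sum_fejer_le`). Averaging this smoothed inequality with the
weight `e ^ y` removes the smoothing (`sum_Ioc_mul_le_of_sum_fejer_le`), with a loss that tends to
`1` when the kernel is concentrated (`exists_fejer_parameters`).
-/

/-! ### Integrality of quotients of Pochhammer symbols -/

theorem commonDen_le {a : ℕ → ℚ} {n d : ℕ} (hd : 0 < d)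
    (h : ∀ k ≤ n, ∃ m : ℤ, (d : ℚ) * a k = m) : commonDen a n ≤ d :=
  Nat.sInf_le ⟨hd, h⟩

theorem poch_eq_prod (x : ℚ) (n : ℕ) : poch x n = ∏ i ∈ Finset.range n, (x + i) := by
  induction n with
  | zero => simp [poch]
  | succ n ih => rw [Finset.prod_range_succ, ← ih, poch, ascPochhammer_succ_eval, poch]

theorem poch_succ_left (x : ℚ) (n : ℕ) : poch x (n + 1) = x * poch (x + 1) n := by
  simp_rw [poch_eq_prod, Finset.prod_range_succ', mul_comm]
  simp [add_assoc, add_comm (1 : ℚ)]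

theorem poch_succ_right (x : ℚ) (n : ℕ) : poch x (n + 1) = poch x n * (x + n) := by
  simp_rw [poch_eq_prod, Finset.prod_range_succ]

/-- Clearing the denominators of the factors of a Pochhammer symbol. -/
theorem den_pow_mul_poch (x : ℚ) (n : ℕ) :
    (x.den : ℚ) ^ n * poch x n = ((∏ i ∈ Finset.range n, (x.num + x.den * i) : ℤ) : ℚ) := by
  have h := Finset.prod_const (s := Finset.range n) (x.den : ℚ)
  rw [Finset.card_range] at h
  rw [poch_eq_prod, ← h, ← Finset.prod_mul_distrib]
  push_cast
  refine Finset.prod_congr rfl fun i _ => ?_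
  rw [mul_add, Rat.den_mul_eq_num]

/-- A product of `n` terms of an arithmetic progression is divisible by every divisor of `n!` that
is coprime to the common difference: up to units, the progression consists of consecutive
residues. -/
theorem dvd_prod_arith_prog {q n a : ℕ} (r : ℤ) (hq : q ∣ n.factorial) (ha : Nat.Coprime a q) :
    (q : ℤ) ∣ ∏ i ∈ Finset.range n, (r + a * i) := by
  rw [← ZMod.intCast_zmod_eq_zero_iff_dvd]
  by_cases hq0 : q = 0
  · exact absurd (Nat.eq_zero_of_zero_dvd (hq0 ▸ hq)) n.factorial_ne_zero
  have : NeZero q := ⟨hq0⟩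
  set u := ZMod.unitOfCoprime a ha
  have hu : (u : ZMod q) = a := ZMod.coe_unitOfCoprime a ha
  set z : ℕ := ((u⁻¹ : (ZMod q)ˣ) * (r : ZMod q) : ZMod q).val
  have hz : (a : ZMod q) * (z : ZMod q) = r := by
    simp only [z, ZMod.natCast_val, ZMod.cast_id', id, ← hu]
    rw [← mul_assoc, Units.mul_inv, one_mul]
  have h2 : ((z.ascFactorial n : ℕ) : ZMod q) = 0 :=
    (ZMod.natCast_eq_zero_iff _ _).2 (hq.trans (Nat.factorial_dvd_ascFactorial z n))
  have h3 : ∏ i ∈ Finset.range n, ((z : ZMod q) + i) = 0 := by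
    rw [← h2, Nat.ascFactorial_eq_prod_range]
    push_cast
    rfl
  push_cast
  calc ∏ i ∈ Finset.range n, ((r : ZMod q) + a * i)
      = ∏ i ∈ Finset.range n, ((a : ZMod q) * (z + i)) :=
        Finset.prod_congr rfl fun i _ => by rw [mul_add, hz]
    _ = 0 := by rw [Finset.prod_mul_distrib, h3, mul_zero]

/-- Prime by prime: the primes dividing `a` are taken care of by `a ^ n`, the other ones by the
progression. -/
theorem factorial_dvd_pow_mul_prod_arith_prog (r : ℤ) (a n : ℕ) :
    (n.factorial : ℤ) ∣ (a : ℤ) ^ n * ∏ i ∈ Finset.range n, (r + a * i) := by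
  rw [Int.natCast_dvd, Nat.dvd_iff_prime_pow_dvd_dvd]
  intro p k hp hk
  rw [← Int.natCast_dvd]
  by_cases hpa : p ∣ a
  · -- `p` divides `n!` at most `n` times, and `a ^ n` at least as often
    have := Fact.mk hp
    have hkn : k ≤ n := ((padicValNat_dvd_iff_le n.factorial_ne_zero).1 hk).trans
      (padicValNat_factorial_le p n)
    refine Dvd.dvd.mul_right ?_ _
    exact_mod_cast (pow_dvd_pow p hkn).trans (pow_dvd_pow_of_dvd hpa n)
  · exact (dvd_prod_arith_prog r hk
      ((hp.coprime_iff_not_dvd.2 hpa).symm.pow_right k)).mul_left _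

/-- The number `den(α)^{2n} (α)ₙ / n!` is an integer. -/
theorem exists_int_den_pow_mul_poch_div_factorial (x : ℚ) (n : ℕ) :
    ∃ m : ℤ, (x.den : ℚ) ^ (2 * n) * (poch x n / (n.factorial : ℚ)) = m := by
  obtain ⟨m, hm⟩ := factorial_dvd_pow_mul_prod_arith_prog x.num x.den n
  refine ⟨m, ?_⟩
  have h : (n.factorial : ℚ) ≠ 0 := by exact_mod_cast n.factorial_ne_zero
  have h2 := den_pow_mul_poch x n
  have h3 : (x.den : ℚ) ^ n * ((x.den : ℚ) ^ n * poch x n) = n.factorial * m := by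
    rw [h2]; exact_mod_cast hm
  field_simp
  rw [← h3]; ring

/-- A common multiple `D` of the denominators of `1 / x, …, 1 / (x + k)` is one for `k! / (x)ₖ₊₁`.
Inductively, `k! / (x)ₖ₊₁` is a difference of two such quotients of lower order, at `x` and at
`x + 1`, so it is an integral combination of the numbers `1 / (x + i)`. -/
theorem exists_int_mul_factorial_div_poch {D : ℚ} (k : ℕ) : ∀ (x : ℚ),
    (∀ i ≤ k, x + i ≠ 0) → (∀ i ≤ k, ∃ m : ℤ, D * (1 / (x + i)) = m) →
    ∃ m : ℤ, D * ((k.factorial : ℚ) / poch x (k + 1)) = m := by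
  induction k with
  | zero =>
    intro x _ h
    simpa [poch_eq_prod] using h 0 le_rfl
  | succ k ih =>
    intro x h0 h
    obtain ⟨m₁, h₁⟩ := ih x (fun i hi => h0 i (by omega)) (fun i hi => h i (by omega))
    obtain ⟨m₂, h₂⟩ := ih (x + 1)
      (fun i hi => by simpa [add_assoc, add_comm (1 : ℚ)] using h0 (i + 1) (by omega))
      (fun i hi => by simpa [add_assoc, add_comm (1 : ℚ)] using h (i + 1) (by omega))
    refine ⟨m₁ - m₂, ?_⟩
    push_cast
    rw [← h₁, ← h₂, ← mul_sub]
    congr 1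
    have hx : x ≠ 0 := by simpa using h0 0 (by omega)
    have hk : x + (k + 1 : ℕ) ≠ 0 := h0 (k + 1) le_rfl
    have hp : poch (x + 1) k ≠ 0 := by
      rw [poch_eq_prod, Finset.prod_ne_zero_iff]
      intro i hi
      have := h0 (i + 1) (by have := Finset.mem_range.1 hi; omega)
      push_cast at this
      rwa [add_assoc, add_comm 1 (i : ℚ)]
    rw [poch_succ_left x (k + 1), poch_succ_left x k, poch_succ_right (x + 1) k,
      Nat.factorial_succ]
    push_cast at hk ⊢
    have hk' : x + 1 + k ≠ 0 := by rwa [add_assoc, add_comm 1 (k : ℚ)]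
    field_simp
    ring

/-- The numerator of `x + i` divides `lcm(1, …, M)` as soon as it is at most `M` in absolute
value. -/
theorem exists_int_lcmUpto_mul_inv {x : ℚ} {M : ℕ} (i : ℕ) (hx : x + i ≠ 0)
    (hM : x.num.natAbs + x.den * i ≤ M) :
    ∃ m : ℤ, (Nat.lcmUpto M : ℚ) * (1 / (x + i)) = m := by
  have hden : (x.den : ℚ) ≠ 0 := by exact_mod_cast x.den_ne_zero
  set t : ℤ := x.num + x.den * i
  have ht : (x.den : ℚ) * (x + i) = t := by
    simp only [t]; push_cast; rw [mul_add, Rat.den_mul_eq_num]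
  have ht0 : (t : ℚ) ≠ 0 := by rw [← ht]; exact mul_ne_zero hden hx
  have hle : t.natAbs ≤ M :=
    (Int.natAbs_add_le _ _).trans ((by simp [Int.natAbs_mul] : _ = _).trans_le hM)
  have hdvd : t.natAbs ∣ Nat.lcmUpto M :=
    Finset.dvd_lcm (f := id) (Finset.mem_Icc.2 ⟨Int.natAbs_pos.2 (by exact_mod_cast ht0), hle⟩)
  obtain ⟨c, hc⟩ := Int.natAbs_dvd.1 (Int.natCast_dvd_natCast.2 hdvd)
  refine ⟨x.den * c, ?_⟩
  have hc' : (Nat.lcmUpto M : ℚ) = t * c := by exact_mod_cast hc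
  rw [hc', ← ht]
  push_cast
  field_simp

/-- The common denominator of the quotients `(α)ₖ / (β)ₖ` is controlled by a power of the
denominator of `α` and a least common multiple of consecutive integers. -/
theorem commonDen_poch_div_poch_le (α : ℚ) {β : ℚ} (hβ : ∀ m : ℕ, β ≠ -(m : ℚ)) (n : ℕ) :
    commonDen (fun k => poch α k / poch β k) n ≤
      α.den ^ (2 * n) * Nat.lcmUpto (β.num.natAbs + β.den * n) := by
  refine commonDen_le (Nat.mul_pos (pow_pos α.pos _) (Nat.lcmUpto_pos _)) fun k hk => ?_
  obtain ⟨m₁, h₁⟩ := exists_int_den_pow_mul_poch_div_factorial α k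
  obtain ⟨m₂, h₂⟩ : ∃ m : ℤ, (Nat.lcmUpto (β.num.natAbs + β.den * n) : ℚ) *
      ((k.factorial : ℚ) / poch β k) = m := by
    cases k with
    | zero => exact ⟨Nat.lcmUpto (β.num.natAbs + β.den * n), by simp [poch_eq_prod]⟩
    | succ k =>
      have hne (i : ℕ) : β + i ≠ 0 := fun h => hβ i (eq_neg_of_add_eq_zero_left h)
      obtain ⟨m, hm⟩ := exists_int_mul_factorial_div_poch k β (fun i _ => hne i) fun i hi =>
        exists_int_lcmUpto_mul_inv i (hne i)
          (Nat.add_le_add_left (Nat.mul_le_mul_left _ (show i ≤ n by omega)) _)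
      refine ⟨(k + 1) * m, ?_⟩
      push_cast
      rw [← hm, Nat.factorial_succ]
      push_cast
      ring
  refine ⟨α.den ^ (2 * (n - k)) * m₁ * m₂, ?_⟩
  have hf : (k.factorial : ℚ) ≠ 0 := by exact_mod_cast k.factorial_ne_zero
  have hpow : (α.den : ℚ) ^ (2 * n) = α.den ^ (2 * (n - k)) * α.den ^ (2 * k) := by
    rw [← pow_add]; congr 1; omega
  push_cast
  rw [← h₁, ← h₂, hpow]
  field_simp

theorem commonDen_poch_div_factorial_le (α : ℚ) (n : ℕ) :
    commonDen (fun k => poch α k / (k.factorial : ℚ)) n ≤ α.den ^ (2 * n) := by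
  refine commonDen_le (pow_pos α.pos _) fun k hk => ?_
  obtain ⟨m, h⟩ := exists_int_den_pow_mul_poch_div_factorial α k
  refine ⟨α.den ^ (2 * (n - k)) * m, ?_⟩
  push_cast
  rw [← h, ← mul_assoc, ← pow_add]
  congr 3
  omega

section Analysis

open Real MeasureTheory Set Topology

/-! ### The Fejér kernel -/

/-- The Fejér kernel `(sin (w / 2) / (w / 2)) ^ 2`, normalised to have the value `1` at `0`; its
integral is left unevaluated. -/
noncomputable def fejer (w : ℝ) : ℝ := sinc (w / 2) ^ 2

theorem fejer_nonneg (w : ℝ) : 0 ≤ fejer w := sq_nonneg _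

theorem continuous_fejer : Continuous fejer :=
  (continuous_sinc.comp (continuous_id.div_const 2)).pow 2

theorem fejer_le (w : ℝ) : fejer w ≤ 5 * (1 + w ^ 2)⁻¹ := by
  rw [← div_eq_mul_inv, le_div_iff₀ (by positivity), mul_add, mul_one]
  have h1 : fejer w ≤ 1 := (sq_le_one_iff_abs_le_one _).2 (abs_sinc_le_one _)
  have h2 : fejer w * w ^ 2 ≤ 4 := by
    by_cases hw : w = 0
    · simp [hw]
    · rw [fejer, sinc_of_ne_zero (by positivity)]
      field_simp
      nlinarith [sin_sq_le_one (w / 2)]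
  linarith

theorem integrable_fejer : Integrable fejer :=
  (integrable_inv_one_add_sq.const_mul 5).mono' continuous_fejer.aestronglyMeasurable
    (Eventually.of_forall fun w => by rw [norm_of_nonneg (fejer_nonneg w)]; exact fejer_le w)

theorem integral_fejer_pos : 0 < ∫ w, fejer w :=
  integral_pos_of_integrable_nonneg_nonzero continuous_fejer integrable_fejer fejer_nonneg
    (x := 0) (by simp [fejer])

theorem integral_one_sub_mul_cexp {w : ℂ} (hw : w ≠ 0) :
    ∫ t in (0 : ℝ)..1, (1 - t : ℂ) * Complex.exp (t * w) =
      Complex.exp w / w ^ 2 - 1 / w - 1 / w ^ 2 := by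
  have hd (t : ℝ) : HasDerivAt (fun t : ℝ => (1 - t : ℂ) * (Complex.exp (t * w) / w) +
      Complex.exp (t * w) / w ^ 2) ((1 - t : ℂ) * Complex.exp (t * w)) t := by
    have h1 : HasDerivAt (fun t : ℝ => (t : ℂ)) 1 t := Complex.ofRealCLM.hasDerivAt
    have h2 := (h1.mul_const w).cexp
    refine (((h1.const_sub 1).mul (h2.div_const w)).add (h2.div_const (w ^ 2))).congr_deriv ?_
    field_simp
    ring
  rw [intervalIntegral.integral_eq_sub_of_hasDerivAt (fun t _ => hd t)
    (Continuous.intervalIntegrable (by fun_prop) _ _)]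
  simp
  ring

/-- The Fejér kernel is the Fourier transform of the triangle function on `[-1, 1]`. So it is
nonnegative and integrable with a compactly supported Fourier transform, which are the properties
that a Tauberian argument without growth conditions on vertical lines needs. -/
theorem integral_triangle_mul_cexp (w : ℝ) :
    ∫ t in (-1 : ℝ)..1, ((1 - |t| : ℝ) : ℂ) * Complex.exp (t * (w * Complex.I)) = fejer w := by
  have hc : Continuous fun t : ℝ => ((1 - |t| : ℝ) : ℂ) * Complex.exp (t * (w * Complex.I)) := by
    fun_prop
  have h2 : ∀ w : ℝ, ∫ t in (0 : ℝ)..1, ((1 - |t| : ℝ) : ℂ) * Complex.exp (t * (w * Complex.I)) =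
      ∫ t in (0 : ℝ)..1, (1 - t : ℂ) * Complex.exp (t * (w * Complex.I)) := fun w => by
    refine intervalIntegral.integral_congr fun t ht => ?_
    rw [uIcc_of_le zero_le_one] at ht
    simp [abs_of_nonneg ht.1]
  have h1 : ∫ t in (-1 : ℝ)..0, ((1 - |t| : ℝ) : ℂ) * Complex.exp (t * (w * Complex.I)) =
      ∫ t in (0 : ℝ)..1, ((1 - |t| : ℝ) : ℂ) * Complex.exp (t * ((-w : ℝ) * Complex.I)) := by
    have := intervalIntegral.integral_comp_neg (a := 0) (b := 1)
      (fun t : ℝ => ((1 - |t| : ℝ) : ℂ) * Complex.exp (t * (w * Complex.I)))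
    simp only [neg_zero] at this
    rw [← this]
    simp
  rw [← intervalIntegral.integral_add_adjacent_intervals (b := 0) (hc.intervalIntegrable _ _)
    (hc.intervalIntegrable _ _), h1, h2, h2]
  by_cases hw : w = 0
  · subst hw
    have : ∫ t in (0 : ℝ)..1, (1 - t : ℂ) = 1 / 2 := by
      have : ∫ t in (0 : ℝ)..1, (1 - t : ℝ) = 1 / 2 := by
        rw [intervalIntegral.integral_sub (by simp) (by simp)]; norm_num
      rw [← Complex.ofReal_inj, ← intervalIntegral.integral_ofReal] at this
      simpa using this
    simp [fejer, this]
    norm_num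
  · have hI (w : ℝ) (hw : w ≠ 0) : (w * Complex.I : ℂ) ≠ 0 := by simp [hw]
    rw [integral_one_sub_mul_cexp (hI w hw), integral_one_sub_mul_cexp (hI (-w) (by simpa)), fejer,
      sinc_of_ne_zero (by positivity), div_pow, sin_sq_eq_half_sub]
    have hcos : (Complex.ofReal (cos (2 * (w / 2)))) =
        (Complex.exp (w * Complex.I) + Complex.exp (-w * Complex.I)) / 2 := by
      rw [mul_div_cancel₀ _ two_ne_zero, Complex.ofReal_cos, Complex.cos]
    push_cast at hcos ⊢
    rw [hcos]
    have hw' : (w : ℂ) ≠ 0 := by exact_mod_cast hw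
    field_simp
    simp only [Complex.I_sq]
    ring

/-! ### The smoothed Tauberian inequality -/

theorem integral_triangle_mul_cexp_mul_term (c : ℕ → ℝ) {σ : ℝ} (hσ : 1 < σ) (l y : ℝ) (n : ℕ) :
    ∫ t in (-1 : ℝ)..1, ((1 - |t| : ℝ) : ℂ) * Complex.exp (t * ((l * y : ℝ) * Complex.I)) *
        LSeries.term (fun n => (c n : ℂ)) (σ + (l * t : ℝ) * Complex.I) n =
      ((c n / (n : ℝ) ^ σ * fejer (l * (y - log n)) : ℝ) : ℂ) := by
  rcases Nat.eq_zero_or_pos n with rfl | hn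
  · simp [zero_rpow (by linarith : σ ≠ 0)]
  have hn0 : (n : ℂ) ≠ 0 := by exact_mod_cast hn.ne'
  rw [Complex.ofReal_mul _ (fejer _), ← integral_triangle_mul_cexp,
      ← intervalIntegral.integral_const_mul]
  refine intervalIntegral.integral_congr fun t _ => ?_
  rw [LSeries.term_of_ne_zero hn.ne', Complex.cpow_add _ _ hn0, Complex.ofReal_div,
    Complex.ofReal_cpow n.cast_nonneg,
    Complex.cpow_def_of_ne_zero hn0 (((l * t : ℝ) : ℂ) * Complex.I), ← Complex.natCast_log]
  have h : Complex.exp (t * ((l * (y - log n) : ℝ) * Complex.I)) =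
      Complex.exp (t * ((l * y : ℝ) * Complex.I)) /
        Complex.exp ((log n : ℝ) * ((l * t : ℝ) * Complex.I)) := by
    rw [← Complex.exp_sub]; congr 1; push_cast; ring
  rw [h]
  push_cast
  field_simp

/-- The Dirichlet series, averaged against the triangle function on a vertical segment of
half-length `l`, becomes a sum that the Fejér kernel concentrates near `log n = y`. -/
theorem hasSum_fejer {c : ℕ → ℝ} {σ : ℝ} (hσ : 1 < σ)
    (hs : LSeriesSummable (fun n => (c n : ℂ)) σ) (l y : ℝ) :
    HasSum (fun n : ℕ => ((c n / (n : ℝ) ^ σ * fejer (l * (y - log n)) : ℝ) : ℂ))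
      (∫ t in (-1 : ℝ)..1, ((1 - |t| : ℝ) : ℂ) * Complex.exp (t * ((l * y : ℝ) * Complex.I)) *
        LSeries (fun n => (c n : ℂ)) (σ + (l * t : ℝ) * Complex.I)) := by
  simp_rw [← integral_triangle_mul_cexp_mul_term c hσ l y]
  have hnorm (t : ℝ) (n : ℕ) : ‖LSeries.term (fun n => (c n : ℂ)) (σ + (l * t : ℝ) * Complex.I) n‖ =
      ‖LSeries.term (fun n => (c n : ℂ)) σ n‖ := by
    rw [LSeries.norm_term_eq, LSeries.norm_term_eq]; simp
  refine intervalIntegral.hasSum_integral_of_dominated_convergence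
    (fun n _ => ‖LSeries.term (fun n => (c n : ℂ)) σ n‖) (fun n => ?_) (fun n => ?_)
    (ae_of_all _ fun t _ => hs.norm) intervalIntegrable_const (ae_of_all _ fun t _ => ?_)
  · refine Continuous.aestronglyMeasurable ?_
    refine Continuous.mul (by fun_prop) ?_
    rcases Nat.eq_zero_or_pos n with rfl | hn
    · simpa using continuous_const
    simp_rw [LSeries.term_of_ne_zero hn.ne']
    have hn0 : (n : ℂ) ≠ 0 := by exact_mod_cast hn.ne'
    refine continuous_const.div (Continuous.const_cpow (by fun_prop) (.inl hn0)) fun t => ?_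
    simp [Complex.cpow_eq_zero_iff, hn0]
  · refine ae_of_all _ fun t ht => ?_
    rw [uIoc_of_le (by norm_num)] at ht
    rw [norm_mul, norm_mul, hnorm, Complex.norm_real]
    have h1 : ‖Complex.exp (t * ((l * y : ℝ) * Complex.I))‖ = 1 := by
      rw [← mul_assoc, ← Complex.ofReal_mul, Complex.norm_exp_ofReal_mul_I]
    have h2 : ‖1 - |t|‖ ≤ 1 := by
      have := abs_le.2 ⟨ht.1.le, ht.2⟩
      rw [norm_of_nonneg (by linarith)]; linarith [abs_nonneg t]
    rw [h1, mul_one]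
    exact mul_le_of_le_one_left (norm_nonneg _) h2
  · refine HasSum.mul_left _ (Summable.hasSum ?_)
    exact .of_norm ((summable_congr (hnorm t)).2 hs.norm)

/-- The contribution of the pole at `s = 1`, by Fubini for `1 / (s - 1) = ∫ e^{-(s-1)v} dv`. -/
theorem integral_triangle_mul_cexp_mul_pole {σ : ℝ} (hσ : 1 < σ) (l y : ℝ) :
    ∫ t in (-1 : ℝ)..1, ((1 - |t| : ℝ) : ℂ) * Complex.exp (t * ((l * y : ℝ) * Complex.I)) *
        (1 / (σ + (l * t : ℝ) * Complex.I - 1)) =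
      ((∫ v in Ioi (0 : ℝ), exp (-(σ - 1) * v) * fejer (l * (y - v)) : ℝ) : ℂ) := by
  have hre (t : ℝ) : (-(σ + (l * t : ℝ) * Complex.I - 1) : ℂ).re < 0 := by simp; linarith
  have h1 : ∀ t : ℝ, ((1 - |t| : ℝ) : ℂ) * Complex.exp (t * ((l * y : ℝ) * Complex.I)) *
        (1 / (σ + (l * t : ℝ) * Complex.I - 1)) = ∫ v in Ioi (0 : ℝ), ((1 - |t| : ℝ) : ℂ) *
        Complex.exp (t * ((l * y : ℝ) * Complex.I)) *
          Complex.exp (-(σ + (l * t : ℝ) * Complex.I - 1) * v) := fun t => by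
    rw [integral_const_mul, integral_exp_mul_complex_Ioi (hre t)]
    rw [Complex.ofReal_zero, mul_zero, Complex.exp_zero, neg_div_neg_eq]
  simp_rw [h1]
  rw [intervalIntegral_integral_swap]
  · rw [← integral_complex_ofReal]
    refine setIntegral_congr_fun measurableSet_Ioi fun v _ => ?_
    rw [Complex.ofReal_mul _ (fejer _), ← integral_triangle_mul_cexp,
      ← intervalIntegral.integral_const_mul]
    refine intervalIntegral.integral_congr fun t _ => ?_
    rw [Complex.ofReal_exp, mul_assoc, ← Complex.exp_add, mul_left_comm (Complex.exp _),
      ← Complex.exp_add]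
    congr 2
    push_cast
    ring
  · have hint : Integrable (fun z : ℝ × ℝ => ((1 - |z.1| : ℝ) : ℝ) * exp (-(σ - 1) * z.2))
        ((volume.restrict (uIoc (-1) 1)).prod (volume.restrict (Ioi 0))) := by
      refine Integrable.mul_prod (f := fun t : ℝ => 1 - |t|)
        (g := fun v : ℝ => exp (-(σ - 1) * v)) ?_
        (integrableOn_exp_mul_Ioi (by linarith) 0)
      rw [uIoc_of_le (by norm_num)]
      exact (Continuous.integrableOn_Icc (by fun_prop)).mono_set Ioc_subset_Icc_self
    refine hint.mono (Continuous.aestronglyMeasurable (by fun_prop)) (ae_of_all _ fun z => ?_)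
    simp only [Function.uncurry, norm_mul, Complex.norm_real, Complex.norm_exp, norm_eq_abs,
      abs_exp]
    simp

/-- The contribution of the pole is at most the full mass of the rescaled kernel, uniformly in `σ`
and `y`. -/
theorem integral_pole_le {σ : ℝ} (hσ : 1 < σ) {l : ℝ} (hl : 0 < l) (y : ℝ) :
    ∫ v in Ioi (0 : ℝ), exp (-(σ - 1) * v) * fejer (l * (y - v)) ≤ (∫ w, fejer w) / l := by
  have hint : Integrable fun v => fejer (l * (y - v)) :=
    (integrable_fejer.comp_mul_left' hl.ne').comp_sub_left y
  calc _ ≤ ∫ v in Ioi (0 : ℝ), fejer (l * (y - v)) := by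
        refine setIntegral_mono_on_ae ?_ hint.integrableOn measurableSet_Ioi
          (ae_of_all _ fun v hv => ?_)
        · refine hint.integrableOn.mono' (Continuous.aestronglyMeasurable ?_) ?_
          · exact (by fun_prop : Continuous fun v : ℝ => exp (-(σ - 1) * v)).mul
              (continuous_fejer.comp (by fun_prop))
          · refine (ae_restrict_iff' measurableSet_Ioi).2 (ae_of_all _ fun v hv => ?_)
            rw [norm_mul, norm_of_nonneg (fejer_nonneg _), norm_of_nonneg (exp_nonneg _)]
            refine mul_le_of_le_one_left (fejer_nonneg _) (exp_le_one_iff.2 ?_)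
            nlinarith [mem_Ioi.1 hv]
        · refine mul_le_of_le_one_left (fejer_nonneg _) (exp_le_one_iff.2 ?_)
          nlinarith [mem_Ioi.1 hv]
    _ ≤ ∫ v, fejer (l * (y - v)) :=
        setIntegral_le_integral hint (ae_of_all _ fun v => fejer_nonneg _)
    _ = (∫ w, fejer w) / l := by
        rw [integral_sub_left_eq_self (fun v => fejer (l * v)) volume y,
          Measure.integral_comp_mul_left, abs_of_pos (inv_pos.2 hl), smul_eq_mul, div_eq_inv_mul]

/-- The smoothed upper bound to the right of the line `re s = 1`. As the coefficients and the kernel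
are nonnegative, every finite part of the series is bounded by the two contributions of the pole and
of the continuous part `G`. -/
theorem sum_fejer_le_of_one_lt {c : ℕ → ℝ} (hc : ∀ n, 0 ≤ c n) {σ : ℝ} (hσ : 1 < σ)
    (hs : LSeriesSummable (fun n => (c n : ℂ)) σ) {G : ℂ → ℂ}
    (hG : ContinuousOn G {s | 1 ≤ s.re})
    (hL : ∀ s : ℂ, 1 < s.re → LSeries (fun n => (c n : ℂ)) s = G s + 1 / (s - 1))
    {l : ℝ} (hl : 0 < l) (y : ℝ) (F : Finset ℕ) :
    ∑ n ∈ F, c n / (n : ℝ) ^ σ * fejer (l * (y - log n)) ≤ (∫ w, fejer w) / l +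
      ‖∫ t in (-1 : ℝ)..1, ((1 - |t| : ℝ) : ℂ) * Complex.exp (t * ((l * y : ℝ) * Complex.I)) *
        G (σ + (l * t : ℝ) * Complex.I)‖ := by
  have h := hasSum_fejer hσ hs l y
  have hre (t : ℝ) : 1 < (σ + (l * t : ℝ) * Complex.I : ℂ).re := by simpa
  have hcG : Continuous fun t : ℝ => G (σ + (l * t : ℝ) * Complex.I) :=
    hG.comp_continuous (by fun_prop) fun t => (hre t).le
  have heq : (∫ t in (-1 : ℝ)..1, ((1 - |t| : ℝ) : ℂ) *
        Complex.exp (t * ((l * y : ℝ) * Complex.I)) *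
        LSeries (fun n => (c n : ℂ)) (σ + (l * t : ℝ) * Complex.I)) =
      (∫ t in (-1 : ℝ)..1, ((1 - |t| : ℝ) : ℂ) * Complex.exp (t * ((l * y : ℝ) * Complex.I)) *
        G (σ + (l * t : ℝ) * Complex.I)) +
      ((∫ v in Ioi (0 : ℝ), exp (-(σ - 1) * v) * fejer (l * (y - v)) : ℝ) : ℂ) := by
    rw [← integral_triangle_mul_cexp_mul_pole hσ, ← intervalIntegral.integral_add]
    · refine intervalIntegral.integral_congr fun t _ => ?_
      rw [hL _ (hre t), mul_add]
    · exact Continuous.intervalIntegrable (.mul (by fun_prop) hcG) _ _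
    · refine Continuous.intervalIntegrable (Continuous.mul (by fun_prop) ?_) _ _
      refine continuous_const.div (by fun_prop) fun t h => ?_
      have := congrArg Complex.re h
      simp at this
      linarith
  rw [heq] at h
  have h' := Complex.hasSum_re h
  simp only [Complex.ofReal_re, Complex.add_re] at h'
  have h2 := sum_le_hasSum F (fun n _ => mul_nonneg (div_nonneg (hc n) (by positivity))
    (fejer_nonneg _)) h'
  linarith [integral_pole_le hσ hl y, Complex.re_le_norm (∫ t in (-1 : ℝ)..1, ((1 - |t| : ℝ) : ℂ) *
    Complex.exp (t * ((l * y : ℝ) * Complex.I)) * G (σ + (l * t : ℝ) * Complex.I))]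

/-- The smoothed bound on the boundary line, obtained by letting `σ` tend to `1`. -/
theorem sum_fejer_le {c : ℕ → ℝ} (hc : ∀ n, 0 ≤ c n)
    (hs : ∀ σ : ℝ, 1 < σ → LSeriesSummable (fun n => (c n : ℂ)) σ) {G : ℂ → ℂ}
    (hG : ContinuousOn G {s | 1 ≤ s.re})
    (hL : ∀ s : ℂ, 1 < s.re → LSeries (fun n => (c n : ℂ)) s = G s + 1 / (s - 1))
    {l : ℝ} (hl : 0 < l) (y : ℝ) (F : Finset ℕ) :
    ∑ n ∈ F, c n / n * fejer (l * (y - log n)) ≤ (∫ w, fejer w) / l +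
      ‖∫ t in (-1 : ℝ)..1, ((1 - |t| : ℝ) : ℂ) * Complex.exp (t * ((l * y : ℝ) * Complex.I)) *
        G (1 + (l * t : ℝ) * Complex.I)‖ := by
  -- `G` is bounded on the compact rectangle that carries the limit
  obtain ⟨C, hC⟩ := ((isCompact_Icc (a := (1 : ℝ)) (b := 2)).prod
    (isCompact_Icc (a := (-1 : ℝ)) (b := 1))).exists_bound_of_continuousOn
    (f := fun p : ℝ × ℝ => G (p.1 + (l * p.2 : ℝ) * Complex.I))
    (hG.comp (by fun_prop) fun p hp => by simpa using hp.1.1)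
  have hline (t : ℝ) : Tendsto (fun σ : ℝ => G (σ + (l * t : ℝ) * Complex.I)) (𝓝[>] 1)
      (𝓝 (G (1 + (l * t : ℝ) * Complex.I))) := by
    have h1 : ContinuousWithinAt G {s | 1 ≤ s.re} (1 + (l * t : ℝ) * Complex.I) :=
      hG _ (by simp)
    refine h1.tendsto.comp (tendsto_nhdsWithin_iff.2 ⟨?_, ?_⟩)
    · have : Continuous fun σ : ℝ => (σ + (l * t : ℝ) * Complex.I : ℂ) := by fun_prop
      simpa using (this.tendsto 1).mono_left nhdsWithin_le_nhds
    · filter_upwards [self_mem_nhdsWithin] with σ hσ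
      simpa using (mem_Ioi.1 hσ).le
  have hlim : Tendsto (fun σ : ℝ => ∫ t in (-1 : ℝ)..1, ((1 - |t| : ℝ) : ℂ) *
      Complex.exp (t * ((l * y : ℝ) * Complex.I)) * G (σ + (l * t : ℝ) * Complex.I)) (𝓝[>] 1)
      (𝓝 (∫ t in (-1 : ℝ)..1, ((1 - |t| : ℝ) : ℂ) *
        Complex.exp (t * ((l * y : ℝ) * Complex.I)) * G (1 + (l * t : ℝ) * Complex.I))) := by
    refine intervalIntegral.tendsto_integral_filter_of_dominated_convergence (fun _ => C) ?_ ?_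
      intervalIntegrable_const (ae_of_all _ fun t _ => (hline t).const_mul _)
    · filter_upwards [self_mem_nhdsWithin] with σ hσ
      have hcG : Continuous fun t : ℝ => G (σ + (l * t : ℝ) * Complex.I) :=
        hG.comp_continuous (by fun_prop) fun t => by simpa using (mem_Ioi.1 hσ).le
      exact Continuous.aestronglyMeasurable (.mul (by fun_prop) hcG)
    · filter_upwards [Ioc_mem_nhdsGT (show (1 : ℝ) < 2 by norm_num)] with σ hσ
      refine ae_of_all _ fun t ht => ?_
      rw [uIoc_of_le (by norm_num)] at ht
      have h1 : ‖Complex.exp (t * ((l * y : ℝ) * Complex.I))‖ = 1 := by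
        rw [← mul_assoc, ← Complex.ofReal_mul, Complex.norm_exp_ofReal_mul_I]
      have h2 : ‖1 - |t|‖ ≤ 1 := by
        have := abs_le.2 ⟨ht.1.le, ht.2⟩
        rw [norm_of_nonneg (by linarith)]; linarith [abs_nonneg t]
      rw [norm_mul, norm_mul, Complex.norm_real, h1, mul_one]
      exact (mul_le_of_le_one_left (norm_nonneg _) h2).trans
        (hC (σ, t) ⟨⟨hσ.1.le, hσ.2⟩, ht.1.le, ht.2⟩)
  refine le_of_tendsto_of_tendsto (f := fun σ : ℝ => ∑ n ∈ F, c n / (n : ℝ) ^ σ *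
    fejer (l * (y - log n))) (b := 𝓝[>] (1 : ℝ)) ?_ (hlim.norm.const_add _) ?_
  · refine tendsto_finsetSum _ fun n _ => ?_
    refine Tendsto.mul_const _ ?_
    rcases Nat.eq_zero_or_pos n with rfl | hn
    · refine Tendsto.congr' ?_ (tendsto_const_nhds (x := c 0 / (0 : ℕ)))
      filter_upwards [self_mem_nhdsWithin] with σ hσ
      simp [zero_rpow (by linarith [mem_Ioi.1 hσ] : σ ≠ 0)]
    · have hn0 : (0 : ℝ) < n := by exact_mod_cast hn
      have : ContinuousAt (fun σ : ℝ => c n / (n : ℝ) ^ σ) 1 :=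
        continuousAt_const.div (continuousAt_const_rpow hn0.ne') (by positivity)
      simpa using this.tendsto.mono_left nhdsWithin_le_nhds
  · filter_upwards [self_mem_nhdsWithin] with σ hσ
    exact sum_fejer_le_of_one_lt hc hσ (hs σ hσ) hG hL hl y F

/-- By the Riemann–Lebesgue lemma the contribution of the continuous part tends to `0` as
`y` tends to infinity. -/
theorem eventually_sum_fejer_le {c : ℕ → ℝ} (hc : ∀ n, 0 ≤ c n)
    (hs : ∀ σ : ℝ, 1 < σ → LSeriesSummable (fun n => (c n : ℂ)) σ) {G : ℂ → ℂ}
    (hG : ContinuousOn G {s | 1 ≤ s.re})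
    (hL : ∀ s : ℂ, 1 < s.re → LSeries (fun n => (c n : ℂ)) s = G s + 1 / (s - 1))
    {l : ℝ} (hl : 0 < l) {ε : ℝ} (hε : 0 < ε) :
    ∀ᶠ y : ℝ in atTop, ∀ F : Finset ℕ,
      ∑ n ∈ F, c n / n * fejer (l * (y - log n)) ≤ (∫ w, fejer w) / l + ε := by
  have hRL := Real.tendsto_integral_exp_smul_cocompact ((Ioc (-1 : ℝ) 1).indicator fun t =>
    ((1 - |t| : ℝ) : ℂ) * G (1 + (l * t : ℝ) * Complex.I))
  have hy : Tendsto (fun y : ℝ => -(l / (2 * π)) * y) atTop (cocompact ℝ) :=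
    (tendsto_id.const_mul_atTop_of_neg (by simp; positivity)).mono_right atBot_le_cocompact
  have h := (hRL.comp hy).norm
  simp only [norm_zero] at h
  filter_upwards [h.eventually_lt_const hε] with y hy F
  refine (sum_fejer_le hc hs hG hL hl y F).trans (add_le_add_right (le_of_eq_of_le ?_ hy.le) _)
  simp only [Function.comp_apply]
  congr 1
  rw [intervalIntegral.integral_of_le (by norm_num), ← integral_indicator measurableSet_Ioc]
  congr 1
  funext t
  by_cases ht : t ∈ Ioc (-1 : ℝ) 1
  · simp only [indicator_of_mem ht]
    have key : ((2 * π * -(t * (-(l / (2 * π)) * y)) : ℝ) : ℂ) * Complex.I =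
        t * ((l * y : ℝ) * Complex.I) := by
      have : (2 * π * -(t * (-(l / (2 * π)) * y)) : ℝ) = t * (l * y) := by
        field_simp
      rw [this]
      push_cast
      ring
    rw [Circle.smul_def, Real.fourierChar_apply, smul_eq_mul, key]
    ring
  · simp [indicator_of_notMem ht]

/-! ### The upper half of the Wiener–Ikehara theorem -/

/-- Undoing the smoothing: `e ^ y` times the smoothed bound is integrated over `[Y, X + δ]`, and the
kernel at `log n` is bounded below by its mass on `[log n - δ, log n + δ]`. -/
theorem sum_Ioc_mul_le_of_sum_fejer_le {c : ℕ → ℝ} (hc : ∀ n, 0 ≤ c n) {l δ B Y X : ℝ}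
    (hδ : 0 < δ) (hYX : Y ≤ X)
    (h : ∀ y ≥ Y, ∀ F : Finset ℕ, ∑ n ∈ F, c n / n * fejer (l * (y - log n)) ≤ B) :
    (∑ n ∈ Finset.Ioc ⌊exp (Y + δ)⌋₊ ⌊exp X⌋₊, c n) *
      (exp (-δ) * ∫ u in (-δ)..δ, fejer (l * u)) ≤ B * exp (X + δ) := by
  set F := Finset.Ioc ⌊exp (Y + δ)⌋₊ ⌊exp X⌋₊
  have hB : 0 ≤ B := by simpa using h Y le_rfl ∅
  have hcont (n : ℕ) : Continuous fun y : ℝ => exp y * fejer (l * (y - log n)) :=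
    continuous_exp.mul (continuous_fejer.comp (by fun_prop))
  have hterm : ∀ n ∈ F, c n * (exp (-δ) * ∫ u in (-δ)..δ, fejer (l * u)) ≤
      c n / n * ∫ y in Y..(X + δ), exp y * fejer (l * (y - log n)) := fun n hn => by
    obtain ⟨hn1, hn2⟩ := Finset.mem_Ioc.1 hn
    have hn0 : (0 : ℝ) < n := by exact_mod_cast (Nat.zero_le _).trans_lt hn1
    have h1 : Y + δ ≤ log n := (le_log_iff_exp_le hn0).2 (Nat.lt_of_floor_lt hn1).le
    have h2 : log n ≤ X := (log_le_iff_le_exp hn0).2 ((Nat.le_floor_iff (exp_nonneg _)).1 hn2)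
    have h3 : n * (exp (-δ) * ∫ u in (-δ)..δ, fejer (l * u)) ≤
        ∫ y in Y..(X + δ), exp y * fejer (l * (y - log n)) := by
      calc n * (exp (-δ) * ∫ u in (-δ)..δ, fejer (l * u))
          = ∫ y in (log n - δ)..(log n + δ), exp (log n - δ) * fejer (l * (y - log n)) := by
            rw [intervalIntegral.integral_const_mul,
              intervalIntegral.integral_comp_sub_right (fun u => fejer (l * u)),
              sub_sub_cancel_left, add_sub_cancel_left, sub_eq_add_neg, exp_add, exp_log hn0,
              mul_assoc]
        _ ≤ ∫ y in (log n - δ)..(log n + δ), exp y * fejer (l * (y - log n)) := by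
            refine intervalIntegral.integral_mono_on (by linarith)
              (Continuous.intervalIntegrable (continuous_const.mul
                (continuous_fejer.comp (by fun_prop))) _ _)
              ((hcont n).intervalIntegrable _ _) fun y hy => ?_
            exact mul_le_mul_of_nonneg_right (exp_le_exp.2 hy.1) (fejer_nonneg _)
        _ ≤ ∫ y in Y..(X + δ), exp y * fejer (l * (y - log n)) :=
            intervalIntegral.integral_mono_interval (by linarith) (by linarith) (by linarith)
              (ae_of_all _ fun y => mul_nonneg (exp_nonneg _) (fejer_nonneg _))
              ((hcont n).intervalIntegrable _ _)
    calc _ = c n / n * (n * (exp (-δ) * ∫ u in (-δ)..δ, fejer (l * u))) := by field_simp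
      _ ≤ _ := mul_le_mul_of_nonneg_left h3 (div_nonneg (hc n) hn0.le)
  calc _ ≤ ∑ n ∈ F, c n / n * ∫ y in Y..(X + δ), exp y * fejer (l * (y - log n)) := by
        rw [Finset.sum_mul]; exact Finset.sum_le_sum hterm
    _ = ∫ y in Y..(X + δ), ∑ n ∈ F, c n / n * (exp y * fejer (l * (y - log n))) := by
        rw [intervalIntegral.integral_finsetSum fun n _ =>
          ((hcont n).const_mul (c n / n)).intervalIntegrable _ _]
        simp
    _ ≤ ∫ y in Y..(X + δ), B * exp y := by
        refine intervalIntegral.integral_mono_on (by linarith)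
          ((continuous_finsetSum _ fun n _ => (hcont n).const_mul (c n / n)).intervalIntegrable _ _)
          ((continuous_exp.const_mul B).intervalIntegrable _ _) fun y hy => ?_
        have := mul_le_mul_of_nonneg_right (h y hy.1 F) (exp_nonneg y)
        rw [Finset.sum_mul] at this
        exact (Finset.sum_congr rfl fun n _ => by ring).trans_le this
    _ ≤ B * exp (X + δ) := by
        rw [intervalIntegral.integral_const_mul, integral_exp]
        exact mul_le_mul_of_nonneg_left (by linarith [exp_pos Y]) hB

/-- The kernel parameters can be chosen with a loss factor arbitrarily close to `1`. -/
theorem exists_fejer_parameters {η : ℝ} (hη : 1 < η) : ∃ δ > 0, ∃ l > 0, ∃ ε > 0,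
    ∃ m > 0, m = exp (-δ) * (∫ u in (-δ)..δ, fejer (l * u)) ∧
      ((∫ w, fejer w) / l + ε) * exp δ ≤ η * m := by
  set I := ∫ w, fejer w with hI
  have hI0 : 0 < I := integral_fejer_pos
  obtain ⟨δ, hδ, hδη⟩ : ∃ δ > 0, exp δ < η * exp (-δ) := by
    have h1 : Tendsto (fun δ : ℝ => exp δ) (𝓝[>] 0) (𝓝 1) := by
      simpa using (continuous_exp.tendsto 0).mono_left nhdsWithin_le_nhds
    have h2 : Tendsto (fun δ : ℝ => η * exp (-δ)) (𝓝[>] 0) (𝓝 η) := by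
      simpa using ((by fun_prop : Continuous fun δ : ℝ => η * exp (-δ)).tendsto 0).mono_left
        nhdsWithin_le_nhds
    obtain ⟨δ, h, hδ⟩ := ((h1.eventually_lt h2 hη).and self_mem_nhdsWithin).exists
    exact ⟨δ, hδ, h⟩
  obtain ⟨l, hl, hlη⟩ : ∃ l > 0,
      I * exp δ < η * exp (-δ) * ∫ u in (-(l * δ))..(l * δ), fejer u := by
    have h1 : Tendsto (fun l : ℝ => l * δ) atTop atTop := tendsto_id.atTop_mul_const hδ
    have h2 := (intervalIntegral_tendsto_integral integrable_fejer
      (tendsto_neg_atTop_atBot.comp h1) h1).const_mul (η * exp (-δ))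
    have h3 : I * exp δ < η * exp (-δ) * I := by
      rw [mul_comm]; exact mul_lt_mul_of_pos_right hδη hI0
    obtain ⟨l, h, hl⟩ := ((h2.eventually_const_lt h3).and (eventually_gt_atTop 0)).exists
    exact ⟨l, hl, h⟩
  have hm : ∫ u in (-δ)..δ, fejer (l * u) = l⁻¹ * ∫ u in (-(l * δ))..(l * δ), fejer u := by
    rw [intervalIntegral.integral_comp_mul_left _ hl.ne', smul_eq_mul, mul_neg]
  set M := ∫ u in (-(l * δ))..(l * δ), fejer u
  have hM : 0 < M := by
    have : 0 < η * exp (-δ) * M := (mul_pos hI0 (exp_pos δ)).trans hlη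
    exact pos_of_mul_pos_right this (by positivity)
  -- this `ε` turns the final inequality into an equality
  refine ⟨δ, hδ, l, hl, (η * exp (-δ) * M - I * exp δ) / (l * exp δ),
    div_pos (by linarith) (by positivity), exp (-δ) * (l⁻¹ * M), by positivity, by rw [hm], ?_⟩
  apply le_of_eq
  field_simp
  ring

/-- The upper half of the Wiener–Ikehara theorem: if a Dirichlet series with nonnegative
coefficients is `1 / (s - 1)` plus a function that extends continuously to `re s = 1`, then the
partial sums of its coefficients are at most `(1 + o(1)) x`. -/
theorem eventually_sum_le_of_LSeries_eq {c : ℕ → ℝ} (hc : ∀ n, 0 ≤ c n)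
    (hs : ∀ σ : ℝ, 1 < σ → LSeriesSummable (fun n => (c n : ℂ)) σ) {G : ℂ → ℂ}
    (hG : ContinuousOn G {s | 1 ≤ s.re})
    (hL : ∀ s : ℂ, 1 < s.re → LSeries (fun n => (c n : ℂ)) s = G s + 1 / (s - 1))
    {η : ℝ} (hη : 1 < η) : ∀ᶠ x : ℝ in atTop, ∑ n ∈ Finset.Ioc 0 ⌊x⌋₊, c n ≤ η * x := by
  obtain ⟨η', hη', hlt⟩ := exists_between hη
  obtain ⟨δ, hδ, l, hl, ε, hε, m, hm, hmI, hle⟩ := exists_fejer_parameters hη'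
  obtain ⟨Y, hY⟩ := eventually_atTop.1 (eventually_sum_fejer_le hc hs hG hL hl hε)
  set S₀ := ∑ n ∈ Finset.Ioc 0 ⌊exp (Y + δ)⌋₊, c n
  have hlarge := (tendsto_id.const_mul_atTop (sub_pos.2 hlt)).eventually_ge_atTop S₀
  filter_upwards [hlarge, eventually_ge_atTop (exp (Y + δ))] with x hx hxY
  have hx0 : 0 < x := (exp_pos _).trans_le hxY
  have hlog : Y ≤ log x := by
    have := (le_log_iff_exp_le hx0).2 hxY
    linarith
  have key := sum_Ioc_mul_le_of_sum_fejer_le hc hδ hlog hY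
  rw [← hmI, exp_add (log x), exp_log hx0, mul_left_comm, mul_comm x] at key
  have key2 : ∑ n ∈ Finset.Ioc ⌊exp (Y + δ)⌋₊ ⌊x⌋₊, c n ≤ η' * x := by
    refine le_of_mul_le_mul_right (key.trans ?_) hm
    nlinarith
  rw [← Finset.sum_Ioc_consecutive _ (Nat.zero_le _) (Nat.floor_mono hxY)]
  simp only [id] at hx
  linarith

/-- The Chebyshev function satisfies `ψ x ≤ (1 + o(1)) x`, the upper half of the prime number
theorem. -/
theorem eventually_psi_le {η : ℝ} (hη : 1 < η) : ∀ᶠ x : ℝ in atTop, Chebyshev.psi x ≤ η * x := by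
  have hΛ : ArithmeticFunction.vonMangoldt.residueClass (1 : ZMod 1) =
      fun n => ArithmeticFunction.vonMangoldt n := by
    funext n
    simp [ArithmeticFunction.vonMangoldt.residueClass, Set.indicator, eq_iff_true_of_subsingleton]
  -- Mathlib has the regular part of the L-series for residue classes; modulo `1` it is
  -- the one of `Λ` itself
  refine eventually_sum_le_of_LSeries_eq (fun _ => ArithmeticFunction.vonMangoldt_nonneg)
    (fun σ hσ => ArithmeticFunction.LSeriesSummable_vonMangoldt (by simpa using hσ))
    (ArithmeticFunction.vonMangoldt.continuousOn_LFunctionResidueClassAux (1 : ZMod 1))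
    (fun s hs => ?_) hη
  have := ArithmeticFunction.vonMangoldt.eqOn_LFunctionResidueClassAux
    (isUnit_one : IsUnit (1 : ZMod 1)) hs
  simp only [hΛ] at this
  rw [this]
  simp

/-! ### Growth of the common denominators -/

theorem limsup_rpow_one_div_le {u : ℕ → ℝ} {C : ℝ} (h : ∀ᶠ n in atTop, u n ^ (1 / (n : ℝ)) ≤ C) :
    limsup (fun n : ℕ => ((u n ^ (1 / (n : ℝ)) : ℝ) : EReal)) atTop ≤ (C : EReal) :=
  limsup_le_of_le (h := h.mono fun _ hn => EReal.coe_le_coe_iff.2 hn)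

theorem eventually_psi_add_mul_le {A b : ℕ} (hb : 0 < b) {γ : ℝ} (hγ : (b : ℝ) < γ) :
    ∀ᶠ n : ℕ in atTop, Chebyshev.psi ((A + b * n : ℕ) : ℝ) ≤ γ * n := by
  have hb' : (0 : ℝ) < b := by exact_mod_cast hb
  obtain ⟨γ', h1, h2⟩ := exists_between hγ
  have hη : 1 < γ' / b := (one_lt_div hb').2 h1
  have htend : Tendsto (fun n : ℕ => ((A + b * n : ℕ) : ℝ)) atTop atTop :=
    tendsto_natCast_atTop_atTop.comp
      (tendsto_atTop_mono (fun n => (Nat.le_mul_of_pos_left n hb).trans (Nat.le_add_left _ A))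
        tendsto_id)
  have hlarge := (tendsto_natCast_atTop_atTop.const_mul_atTop
    (sub_pos.2 h2)).eventually_ge_atTop (γ' / b * A)
  filter_upwards [htend.eventually (eventually_psi_le hη), hlarge] with n hn hl
  refine hn.trans ?_
  push_cast
  have : γ' / b * (A + b * n) = γ' / b * A + γ' * n := by field_simp
  linarith

theorem pow_two_mul_rpow_one_div {x : ℝ} (hx : 0 ≤ x) {n : ℕ} (hn : 1 ≤ n) :
    (x ^ (2 * n)) ^ (1 / (n : ℝ)) = x ^ 2 := by
  rw [pow_mul, one_div, pow_rpow_inv_natCast (pow_nonneg hx 2) (by omega)]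

theorem limsup_commonDen_poch_div_poch_le (α : ℚ) {β : ℚ} (hβ : ∀ m : ℕ, β ≠ -(m : ℚ)) :
    limsup (fun n : ℕ =>
        (((commonDen (fun k => poch α k / poch β k) n : ℝ) ^ (1 / (n : ℝ)) : ℝ) : EReal)) atTop
      ≤ (((α.den : ℝ) ^ 2 * exp (β.den : ℝ) : ℝ) : EReal) := by
  -- the bound with any `γ > den β` in the exponent, then `γ` tends to `den β`
  have hγ : ∀ γ : ℝ, (β.den : ℝ) < γ → limsup (fun n : ℕ =>
      (((commonDen (fun k => poch α k / poch β k) n : ℝ) ^ (1 / (n : ℝ)) : ℝ) : EReal)) atTop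
        ≤ (((α.den : ℝ) ^ 2 * Real.exp γ : ℝ) : EReal) := fun γ hγ => by
    refine limsup_rpow_one_div_le ?_
    filter_upwards [eventually_psi_add_mul_le (A := β.num.natAbs) β.pos hγ,
      eventually_ge_atTop 1] with n hn hn1
    rw [Chebyshev.psi_eq_log_lcmUpto,
      log_le_iff_le_exp (by exact_mod_cast Nat.lcmUpto_pos _)] at hn
    have h : (commonDen (fun k => poch α k / poch β k) n : ℝ) ≤
        (α.den : ℝ) ^ (2 * n) * exp (γ * n) :=
      (by exact_mod_cast commonDen_poch_div_poch_le α hβ n :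
        (commonDen (fun k => poch α k / poch β k) n : ℝ) ≤ (α.den : ℝ) ^ (2 * n) *
          Nat.lcmUpto (β.num.natAbs + β.den * n)).trans (by gcongr)
    refine (rpow_le_rpow (Nat.cast_nonneg _) h (by positivity)).trans_eq ?_
    have hn0 : (n : ℝ) ≠ 0 := by positivity
    rw [mul_rpow (by positivity) (exp_nonneg _), pow_two_mul_rpow_one_div (by positivity) hn1,
      ← exp_mul, mul_assoc, mul_one_div_cancel hn0, mul_one]
  have hlim : Tendsto (fun γ : ℝ => (((α.den : ℝ) ^ 2 * Real.exp γ : ℝ) : EReal))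
      (𝓝[>] (β.den : ℝ)) (𝓝 (((α.den : ℝ) ^ 2 * Real.exp (β.den : ℝ) : ℝ) : EReal)) :=
    ((continuous_coe_real_ereal.comp (by fun_prop)).tendsto (β.den : ℝ)).mono_left
      nhdsWithin_le_nhds
  exact ge_of_tendsto hlim (by filter_upwards [self_mem_nhdsWithin] with γ h using hγ γ h)

theorem limsup_commonDen_poch_div_factorial_le (α : ℚ) :
    limsup (fun n : ℕ =>
        (((commonDen (fun k => poch α k / (k.factorial : ℚ)) n : ℝ) ^ (1 / (n : ℝ)) : ℝ) :
          EReal)) atTop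
      ≤ (((α.den : ℝ) ^ 2 : ℝ) : EReal) := by
  refine limsup_rpow_one_div_le ?_
  filter_upwards [eventually_ge_atTop 1] with n hn
  refine (rpow_le_rpow (Nat.cast_nonneg _)
    (by exact_mod_cast commonDen_poch_div_factorial_le α n :
      (commonDen (fun k => poch α k / (k.factorial : ℚ)) n : ℝ) ≤ (α.den : ℝ) ^ (2 * n))
    (by positivity)).trans_eq (pow_two_mul_rpow_one_div (by positivity) hn)

end Analysis

/- The upper limits are taken in `EReal`, where they need no boundedness assumption; in
particular each inequality contains the finiteness of the upper limit. -/
theorem mainTheorem5 (α β : ℚ) (hα : ∀ m : ℕ, α ≠ -(m : ℚ)) (hβ : ∀ m : ℕ, β ≠ -(m : ℚ)) :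
    limsup (fun n : ℕ =>
        (((commonDen (fun k => poch α k / poch β k) n : ℝ) ^ (1 / (n : ℝ)) : ℝ) : EReal)) atTop
      ≤ (((α.den : ℝ) ^ 2 * Real.exp (β.den : ℝ) : ℝ) : EReal) ∧
    (∀ n : ℕ, 1 ≤ n →
      ∃ m : ℤ, (α.den : ℚ) ^ (2 * n) * (poch α n / (n.factorial : ℚ)) = m) ∧
    limsup (fun n : ℕ =>
        (((commonDen (fun k => poch α k / (k.factorial : ℚ)) n : ℝ) ^ (1 / (n : ℝ)) : ℝ) :
          EReal)) atTop
      ≤ (((α.den : ℝ) ^ 2 : ℝ) : EReal) := by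
  exact ⟨limsup_commonDen_poch_div_poch_le α hβ,
    fun n _ => exists_int_den_pow_mul_poch_div_factorial α n,
    limsup_commonDen_poch_div_factorial_le α⟩
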